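/- Let $1\le p\le q$ be integers. Let $\mathrm{SW}_{p,q}$ be the set of real block matrices of size $(q-p)+p$ of the form $R=\begin{pmatrix}1&0\\ 2L&M+N\end{pmatrix}$, where $L$ is a $p\times(q-p)$ matrix, $M=M^t$ and $N=-N^t$ are $p\times p$ matrices, that satisfy $R+R^t>0$ (positive definite); equivalently, $M-LL^t>0$. Write $[A]_j$ for the left upper $j\times j$ block of a matrix $A$, and let $dL$, $dM$, $dN$ be the Lebesgue measures $dL=\prod_{i,j}dL_{ij}$, $dM=\prod_{i\le j}dM_{ij}$, $dN=\prod_{i<j}dN_{ij}$. Let $\lambda_1,\dots,\lambda_p,\sigma_1,\dots,\sigma_p\in\mathbb C$, put $\lambda_{p+1}=\sigma_{p+1}=0$, and assume that for all $k=1,\dots,p$ $$\tfrac12(q+k)-1<\operatorname{Re}\lambda_k<\operatorname{Re}\sigma_k-\tfrac12(p-k).$$ Then the following two integrals converge absolutely, and $$\int_{\mathrm{SW}_{p,q}}\prod_{j=1}^p\frac{\det[M-LL^t]_j^{\lambda_j-\lambda_{j+1}}}{\det[1+M+N]_j^{\sigma_j-\sigma_{j+1}}}\cdot\det(M-LL^t)^{-(p+q)/2}\,dM\,dN\,dL$$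 $$=\int_{M-LL^t>0,\ N=-N^t}\prod_{j=1}^p\frac{\det\left[\begin{pmatrix}1&L^t\\L&M\end{pmatrix}\right]_{q-p+j}^{\lambda_j-\lambda_{j+1}}}{\det[1+M+N]_j^{\sigma_j-\sigma_{j+1}}}\cdot\det\begin{pmatrix}1&L^t\\L&M\end{pmatrix}^{-(p+q)/2}\,dL\,dM\,dN$$ $$=\prod_{k=1}^p\pi^{k+(q-p)/2-1}\,\frac{\Gamma\bigl(\lambda_k-\tfrac12(q+k)+1\bigr)\,\Gamma\bigl(\sigma_k-\lambda_k-\tfrac12(p-k)\bigr)}{\Gamma(\sigma_k-p+k)}.$$ -/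

import Mathlib

open MeasureTheory

namespace WedgeB

/-- `minor A j` is `det [A]_j`, the determinant of the left upper `j × j` block of `A`. -/
def minor {n : ℕ} (A : Matrix (Fin n) (Fin n) ℝ) (j : ℕ) : ℝ :=
  (A.submatrix (fun i : {i : Fin n // (i : ℕ) < j} => i.1)
    (fun i : {i : Fin n // (i : ℕ) < j} => i.1)).det

/-- The wedge of dissipative matrices: all real square `R` with `R + Rᵗ > 0`. -/
def wedge (n : Type*) : Set (Matrix n n ℝ) :=
  {R | (R + R.transpose).PosDef}

/-- The section of the wedge `W_q`, `q = m + p`: all block matrices `R` of size `m + p` with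
first block row `(1 0)` that satisfy `R + Rᵗ > 0`. -/
def sectionOfWedge (m p : ℕ) : Set (Matrix (Fin m ⊕ Fin p) (Fin m ⊕ Fin p) ℝ) :=
  {R | R ∈ wedge (Fin m ⊕ Fin p) ∧ ∃ (Q : Matrix (Fin p) (Fin m) ℝ)
    (H : Matrix (Fin p) (Fin p) ℝ), R = Matrix.fromBlocks 1 0 Q H}

/-- Linear coordinates for the triples `(L, M, N)`: the entries of the `p × m` matrix `L`, the
entries `M i j` with `i ≤ j` of the symmetric matrix `M`, and the entries `N i j` with `i < j` of
the skew-symmetric matrix `N`. The measure `dL dM dN` is the Lebesgue measure `volume` in these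
coordinates. -/
abbrev Coords (m p : ℕ) : Type :=
  (Fin p → Fin m → ℝ) × ({ij : Fin p × Fin p // ij.1 ≤ ij.2} → ℝ) ×
    ({ij : Fin p × Fin p // ij.1 < ij.2} → ℝ)

/-- The matrix `L` with given coordinates. -/
def matL {m p : ℕ} (x : Coords m p) : Matrix (Fin p) (Fin m) ℝ :=
  Matrix.of x.1

/-- The symmetric matrix `M` with given coordinates. -/
def matM {m p : ℕ} (x : Coords m p) : Matrix (Fin p) (Fin p) ℝ :=
  Matrix.of fun i j =>
    if h : i ≤ j then x.2.1 ⟨(i, j), h⟩ else x.2.1 ⟨(j, i), (not_le.mp h).le⟩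

/-- The skew-symmetric matrix `N` with given coordinates. -/
def matN {m p : ℕ} (x : Coords m p) : Matrix (Fin p) (Fin p) ℝ :=
  Matrix.of fun i j =>
    if h : i < j then x.2.2 ⟨(i, j), h⟩
    else if h' : j < i then -x.2.2 ⟨(j, i), h'⟩ else 0

/-- The block matrix `R = (1 0; 2L M+N)`. -/
def matR {m p : ℕ} (x : Coords m p) : Matrix (Fin m ⊕ Fin p) (Fin m ⊕ Fin p) ℝ :=
  Matrix.fromBlocks 1 0 ((2 : ℝ) • matL x) (matM x + matN x)

/-- The block matrix `(1 Lᵗ; L M)`, its rows and columns numbered from `0` to `m + p - 1`. -/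
def matBlock {m p : ℕ} (x : Coords m p) : Matrix (Fin (m + p)) (Fin (m + p)) ℝ :=
  Matrix.reindex finSumFinEquiv finSumFinEquiv
    (Matrix.fromBlocks 1 (matL x).transpose (matL x) (matM x))

/-- The section of the wedge as a domain of integration in the coordinates `(L, M, N)`. -/
def sectionDomain (m p : ℕ) : Set (Coords m p) :=
  {x | matR x ∈ sectionOfWedge m p}

/-- The same domain, described by `M - L Lᵗ > 0`, `N = -Nᵗ`. -/
def posDomain (m p : ℕ) : Set (Coords m p) :=
  {x | (matM x - matL x * (matL x).transpose).PosDef ∧ matN x = -(matN x).transpose}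

/-- The integrand
`∏_j det[M - L Lᵗ]_j ^ (λ_j - λ_{j+1}) / det[1 + M + N]_j ^ (σ_j - σ_{j+1})
  * det(M - L Lᵗ) ^ (-(p + q) / 2)`, with `q = m + p`. -/
noncomputable def integrandSchur {m p : ℕ} (lam sig : ℕ → ℂ) (x : Coords m p) : ℂ :=
  (∏ j ∈ Finset.Icc 1 p,
    (minor (matM x - matL x * (matL x).transpose) j : ℂ) ^ (lam j - lam (j + 1)) /
      (minor (1 + matM x + matN x) j : ℂ) ^ (sig j - sig (j + 1))) *
  ((matM x - matL x * (matL x).transpose).det : ℂ) ^ (-((p : ℂ) + ((m : ℂ) + (p : ℂ))) / 2)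

/-- The integrand
`∏_j det[(1 Lᵗ; L M)]_{q-p+j} ^ (λ_j - λ_{j+1}) / det[1 + M + N]_j ^ (σ_j - σ_{j+1})
  * det (1 Lᵗ; L M) ^ (-(p + q) / 2)`, with `q = m + p`. -/
noncomputable def integrandBlock {m p : ℕ} (lam sig : ℕ → ℂ) (x : Coords m p) : ℂ :=
  (∏ j ∈ Finset.Icc 1 p,
    (minor (matBlock x) (m + j) : ℂ) ^ (lam j - lam (j + 1)) /
      (minor (1 + matM x + matN x) j : ℂ) ^ (sig j - sig (j + 1))) *
  ((matBlock x).det : ℂ) ^ (-((p : ℂ) + ((m : ℂ) + (p : ℂ))) / 2)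

/-- Every point of the section of the wedge is `matR x` for exactly one `x`, so that integrals
over the section with respect to `dL dM dN` may be written in the coordinates. -/
theorem existsUnique_coords {m p : ℕ} {R : Matrix (Fin m ⊕ Fin p) (Fin m ⊕ Fin p) ℝ}
    (hR : R ∈ sectionOfWedge m p) : ∃! x : Coords m p, matR x = R := by
  obtain ⟨-, Q, H, rfl⟩ := hR
  refine ⟨(fun i j => Q i j / 2, fun ij => (H ij.1.1 ij.1.2 + H ij.1.2 ij.1.1) / 2,
    fun ij => (H ij.1.1 ij.1.2 - H ij.1.2 ij.1.1) / 2), ?_, ?_⟩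
  · simp only [matR, Matrix.fromBlocks_inj, true_and]
    refine ⟨?_, ?_⟩
    · ext i j
      simp only [matL, Matrix.smul_apply, Matrix.of_apply, smul_eq_mul]
      ring
    · ext i j
      simp only [matM, matN, Matrix.add_apply, Matrix.of_apply]
      rcases lt_trichotomy i j with h | h | h
      · simp only [h.le, h, dite_true]
        ring
      · subst h
        simp
      · simp only [not_le.mpr h, not_lt.mpr h.le, h, dite_true, dite_false]
        ring
  · rintro ⟨a, b, c⟩ hx
    simp only [matR, Matrix.fromBlocks_inj, true_and] at hx
    obtain ⟨h1, h2⟩ := hx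
    refine Prod.ext ?_ (Prod.ext ?_ ?_)
    · funext i j
      have := congrFun (congrFun h1 i) j
      simp only [matL, Matrix.smul_apply, Matrix.of_apply, smul_eq_mul] at this
      simp only
      linarith
    · funext ⟨⟨i, j⟩, h⟩
      have e1 := congrFun (congrFun h2 i) j
      have e2 := congrFun (congrFun h2 j) i
      simp only [matM, matN, Matrix.add_apply, Matrix.of_apply] at e1 e2
      simp only at h ⊢
      rcases h.lt_or_eq with h' | h'
      · simp only [h, h', not_le.mpr h', not_lt.mpr h, dite_true, dite_false] at e1 e2
        linarith
      · subst h'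
        simp at e1
        linarith
    · funext ⟨⟨i, j⟩, h⟩
      have e1 := congrFun (congrFun h2 i) j
      have e2 := congrFun (congrFun h2 j) i
      simp only [matM, matN, Matrix.add_apply, Matrix.of_apply] at e1 e2
      simp only at h ⊢
      simp only [h, h.le, not_le.mpr h, not_lt.mpr h.le, dite_true, dite_false] at e1 e2
      linarith

end WedgeB

/-!
The integrals are computed by integrating out the last row and column of `L`, `M`, `N` and induction
on `p`.

Put `S = M - L Lᵗ` and `A = 1 + M + N`. The two integrands agree because the leading minors of
`(1 Lᵗ; L M)` are those of its Schur complement `S` (`minor_matBlock`). Among the leading minors of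
`S` and `A`, only the full determinants involve the last row `l` of `L`, the last column `(b, c)` of
`M` and the last column `n` of `N`. Over fixed left upper blocks `S'`, `A'`, choose `E` with
`Eᵗ S' E = 1` and write the last column of `A` as `A' w` and that of `S` as `S' (w + E v)`, up to
the last entries, and `l = l' + Lᵗ w`. With `s` the Schur complement of `S'` in `S` this gives
`det S = det S' * s` and `det A = det A' * (1 + s + |w|² + |l'|² + |v|²)`
(`schur_det_of_restrictCoords`, `shifted_det_of_restrictCoords`): the quadratic form becomes a sum
of squares. The substitution is composed of shears and the linear maps `w ↦ A' w`, `v ↦ S' E v`, so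
its Jacobian is `det A' * √(det S')` (`measurePreserving_fibreMap`).

The integral over the fibre is therefore a constant times a power of `det S'` and `det A'`. These
powers turn `λ` and `σ` into `λ - 1/2` and `σ - 1`, which is the same problem for `p - 1`, and the
factors on the right hand side with index `k < p` are invariant under this change
(`gammaFactor_succ`). For this to work without a boundary term, the integrand is considered for
arbitrary `λ_{p+1}`, `σ_{p+1}` (`extIntegrand`). The constant is
`∫ s ^ (a - 1) (1 + s + |z|²) ^ (-σ)` over `s > 0` and Euclidean `z`, which a Gamma integral for the
power `-σ` reduces to Gaussian and Gamma integrals (`integrable_model_and_integral`). The same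
computation with absolute values gives absolute convergence.
-/

namespace WedgeB

open scoped Matrix

/-! ### Leading minors and Schur complements -/

lemma minor_eq_det_submatrix {n j : ℕ} {κ : Type*} [Fintype κ] [DecidableEq κ]
    (A : Matrix (Fin n) (Fin n) ℝ) (e : κ ≃ {i : Fin n // (i : ℕ) < j}) :
    minor A j = (A.submatrix (fun k => (e k).1) (fun k => (e k).1)).det := by
  unfold minor
  rw [← Matrix.det_submatrix_equiv_self e]
  rfl

lemma minor_self {n : ℕ} (A : Matrix (Fin n) (Fin n) ℝ) : minor A n = A.det := by
  rw [minor_eq_det_submatrix A (Equiv.subtypeUnivEquiv fun i : Fin n => i.2).symm]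
  rfl

lemma minor_succ {n j : ℕ} (A : Matrix (Fin (n + 1)) (Fin (n + 1)) ℝ) (hj : j ≤ n) :
    minor A j = minor (A.submatrix Fin.castSucc Fin.castSucc) j := by
  let e : {i : Fin n // (i : ℕ) < j} ≃ {i : Fin (n + 1) // (i : ℕ) < j} :=
    { toFun := fun i => ⟨i.1.castSucc, i.2⟩
      invFun := fun i => ⟨⟨i.1, i.2.trans_le hj⟩, i.2⟩
      left_inv := fun i => rfl
      right_inv := fun i => rfl }
  rw [minor_eq_det_submatrix A e]
  rfl

/-- If the last column of `X` is, up to its last entry, the combination of the other columns with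
coefficients `r`, then subtracting this combination clears it above the corner. -/
lemma det_succ_of_mulVec {n : ℕ} (X : Matrix (Fin (n + 1)) (Fin (n + 1)) ℝ)
    (h0 : (X.submatrix Fin.castSucc Fin.castSucc).det ≠ 0) (r : Fin n → ℝ)
    (hr : ∀ i : Fin n, X i.castSucc (Fin.last n) =
      (X.submatrix Fin.castSucc Fin.castSucc *ᵥ r) i) :
    X.det = (X.submatrix Fin.castSucc Fin.castSucc).det *
      (X (Fin.last n) (Fin.last n) - (fun i : Fin n => X (Fin.last n) i.castSucc) ⬝ᵥ r) := by
  set A := X.submatrix Fin.castSucc Fin.castSucc with hA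
  let B : Matrix (Fin n) (Fin 1) ℝ := Matrix.of fun i _ => X i.castSucc (Fin.last n)
  let C : Matrix (Fin 1) (Fin n) ℝ := Matrix.of fun _ i => X (Fin.last n) i.castSucc
  let D : Matrix (Fin 1) (Fin 1) ℝ := Matrix.of fun _ _ => X (Fin.last n) (Fin.last n)
  have hX : X.submatrix finSumFinEquiv finSumFinEquiv = Matrix.fromBlocks A B C D := by
    ext i j
    rcases i with i | i <;> rcases j with j | j
    · rfl
    · fin_cases j; rfl
    · fin_cases i; rfl
    · fin_cases i; fin_cases j; rfl
  let _ : Invertible A := A.invertibleOfIsUnitDet (isUnit_iff_ne_zero.2 h0)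
  have hB : B = A * Matrix.of fun i _ => r i := by
    ext i j
    simpa [B, Matrix.mul_apply, Matrix.mulVec, dotProduct] using hr i
  rw [← Matrix.det_submatrix_equiv_self finSumFinEquiv X, hX, Matrix.det_fromBlocks₁₁, hB,
    Matrix.mul_assoc, Matrix.invOf_mul_cancel_left, Matrix.det_unique (n := Fin 1)]
  simp [C, D, Matrix.mul_apply, dotProduct]

/-- The inductive step of Sylvester's criterion. -/
lemma posDef_succ_iff {n : ℕ} {X : Matrix (Fin (n + 1)) (Fin (n + 1)) ℝ} (hX : X.IsHermitian) :
    X.PosDef ↔ (X.submatrix Fin.castSucc Fin.castSucc).PosDef ∧ 0 < X.det := by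
  refine ⟨fun h => ⟨h.submatrix (Fin.castSucc_injective n), h.det_pos⟩, fun ⟨hA, hdet⟩ => ?_⟩
  set A := X.submatrix Fin.castSucc Fin.castSucc with hA'
  let B : Matrix (Fin n) (Fin 1) ℝ := Matrix.of fun i _ => X i.castSucc (Fin.last n)
  let D : Matrix (Fin 1) (Fin 1) ℝ := Matrix.of fun _ _ => X (Fin.last n) (Fin.last n)
  have hXB : X.submatrix finSumFinEquiv finSumFinEquiv = Matrix.fromBlocks A B Bᴴ D := by
    ext i j
    rcases i with i | i <;> rcases j with j | j
    · rfl
    · fin_cases j; rfl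
    · fin_cases i; exact (hX.apply _ _).symm
    · fin_cases i; fin_cases j; rfl
  let _ : Invertible A := A.invertibleOfIsUnitDet (isUnit_iff_ne_zero.2 hA.det_pos.ne')
  have hd : X.det = A.det * (D - Bᴴ * A⁻¹ * B) 0 0 := by
    rw [← Matrix.det_submatrix_equiv_self finSumFinEquiv X, hXB, Matrix.det_fromBlocks₁₁,
      Matrix.det_unique (n := Fin 1), Matrix.invOf_eq_nonsing_inv]
    rfl
  have hpos : 0 < (D - Bᴴ * A⁻¹ * B) 0 0 := by
    rw [hd] at hdet
    exact pos_of_mul_pos_right hdet hA.det_pos.le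
  have hS : (D - Bᴴ * A⁻¹ * B) = Matrix.diagonal fun _ => (D - Bᴴ * A⁻¹ * B) 0 0 := by
    ext i j
    fin_cases i; fin_cases j; simp
  have hpsd : X.PosSemidef := by
    rw [← Matrix.posSemidef_submatrix_equiv (finSumFinEquiv (m := n) (n := 1)), hXB,
      Matrix.PosDef.fromBlocks₁₁ _ _ hA, hS, Matrix.posSemidef_diagonal_iff]
    exact fun _ => hpos.le
  exact hpsd.posDef_iff_det_ne_zero.2 hdet.ne'

/-- A real matrix with positive definite symmetric part has positive determinant: the segment from
it to `1` consists of such matrices, and these are all invertible. -/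
lemma det_pos_of_add_transpose_posDef {n : Type*} [Fintype n] [DecidableEq n]
    {X : Matrix n n ℝ} (h : (X + Xᵀ).PosDef) : 0 < X.det := by
  have hinv : ∀ Y : Matrix n n ℝ, (Y + Yᵀ).PosDef → Y.det ≠ 0 := by
    intro Y hY h0
    obtain ⟨v, hv, hYv⟩ := Matrix.exists_mulVec_eq_zero_iff.2 h0
    have := hY.dotProduct_mulVec_pos hv
    rw [Matrix.add_mulVec, hYv, zero_add, Matrix.mulVec_transpose, star_trivial,
      dotProduct_comm, ← Matrix.dotProduct_mulVec, hYv, dotProduct_zero] at this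
    exact this.false
  let f : ℝ → ℝ := fun t => ((1 - t) • (1 : Matrix n n ℝ) + t • X).det
  have hf : Continuous f := by
    apply Continuous.matrix_det
    fun_prop
  have hne : ∀ t ∈ Set.Icc (0 : ℝ) 1, f t ≠ 0 := by
    intro t ht
    apply hinv
    have e : (1 - t) • (1 : Matrix n n ℝ) + t • X + ((1 - t) • (1 : Matrix n n ℝ) + t • X)ᵀ =
        (2 * (1 - t)) • (1 : Matrix n n ℝ) + t • (X + Xᵀ) := by
      rw [Matrix.transpose_add, Matrix.transpose_smul, Matrix.transpose_smul,
        Matrix.transpose_one]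
      module
    rw [e]
    rcases ht.1.eq_or_lt with rfl | h0
    · simpa using (Matrix.PosDef.one (n := n) (R := ℝ)).smul (a := (2 : ℝ)) two_pos
    · exact Matrix.PosDef.posSemidef_add
        (Matrix.PosSemidef.one.smul (by linarith [ht.2])) (h.smul h0)
  by_contra hneg
  have h1 : f 1 ≤ 0 := by simpa [f] using hneg
  have h0 : 0 ≤ f 0 := by simp [f]
  obtain ⟨t, ht, ht0⟩ := intermediate_value_Icc' zero_le_one hf.continuousOn ⟨h1, h0⟩
  exact hne t ht ht0

open scoped MatrixOrder Matrix.Norms.L2Operator in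
/-- Coordinates in which the quadratic form of `S` is the sum of squares; `E` is the symmetric
square root of `S⁻¹`. -/
lemma exists_symm_mul_mul_eq_one {n : Type*} [Fintype n] [DecidableEq n]
    {S : Matrix n n ℝ} (h : S.PosDef) :
    ∃ E : Matrix n n ℝ, Eᵀ * S * E = 1 ∧ |(S * E).det| = √S.det := by
  have hi : S⁻¹.PosSemidef := h.inv.posSemidef
  have hu : IsUnit S.det := isUnit_iff_ne_zero.2 h.det_pos.ne'
  set E := CFC.sqrt S⁻¹
  have hEE : E * E = S⁻¹ := CFC.sqrt_mul_sqrt_self S⁻¹ hi.nonneg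
  have hT : Eᵀ = E := (Matrix.nonneg_iff_posSemidef.1 (CFC.sqrt_nonneg S⁻¹)).isHermitian
  have h1 : S * E * E = 1 := by rw [Matrix.mul_assoc, hEE, Matrix.mul_nonsing_inv _ hu]
  refine ⟨E, ?_, ?_⟩
  · rw [hT, Matrix.mul_assoc]
    exact mul_eq_one_comm.1 h1
  · have h2 : S.det * (E.det * E.det) = 1 := by
      rw [← Matrix.det_mul, ← Matrix.det_mul, ← Matrix.mul_assoc, h1, Matrix.det_one]
    rw [eq_comm, Real.sqrt_eq_iff_mul_self_eq h.det_pos.le (abs_nonneg _), abs_mul_abs_self,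
      Matrix.det_mul]
    linear_combination (-S.det) * h2

/-! ### The model integral over a fibre -/

/-- `IsGaussianForm Q d` says that `Q ≥ 0` behaves like a sum of `2 d` squares of coordinates
with respect to the volume: `∫ exp (-t Q) = (π / t) ^ d` for all `t > 0`. -/
def IsGaussianForm {Z : Type*} [MeasureSpace Z] (Q : Z → ℝ) (d : ℝ) : Prop :=
  Measurable Q ∧ (∀ z, 0 ≤ Q z) ∧ ∀ t : ℝ, 0 < t →
    Integrable (fun z => Real.exp (-t * Q z)) ∧
      ∫ z, Real.exp (-t * Q z) = (Real.pi / t) ^ d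

lemma isGaussianForm_sum_sq (n : ℕ) :
    IsGaussianForm (fun z : Fin n → ℝ => ∑ i, z i ^ 2) ((n : ℝ) / 2) := by
  refine ⟨by fun_prop, fun z => Finset.sum_nonneg fun i _ => sq_nonneg _, fun t ht => ?_⟩
  have e : (fun z : Fin n → ℝ => Real.exp (-t * ∑ i, z i ^ 2)) =
      fun z => ∏ i, Real.exp (-t * z i ^ 2) := by
    funext z
    rw [Finset.mul_sum, Real.exp_sum]
  rw [e]
  refine ⟨Integrable.fintype_prod (f := fun _ x => Real.exp (-t * x ^ 2))
    fun _ => integrable_exp_neg_mul_sq ht, ?_⟩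
  rw [integral_fintype_prod_volume_eq_pow (fun x : ℝ => Real.exp (-t * x ^ 2)),
    integral_gaussian, Fintype.card_fin, Real.sqrt_eq_rpow, ← Real.rpow_natCast,
    ← Real.rpow_mul (div_pos Real.pi_pos ht).le]
  congr 1
  ring

lemma IsGaussianForm.add {Z W : Type*} [MeasureSpace Z] [MeasureSpace W]
    [SFinite (volume : Measure Z)] [SFinite (volume : Measure W)]
    {Q : Z → ℝ} {P : W → ℝ} {d e : ℝ} (hQ : IsGaussianForm Q d) (hP : IsGaussianForm P e) :
    IsGaussianForm (fun z : Z × W => Q z.1 + P z.2) (d + e) := by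
  refine ⟨(hQ.1.comp measurable_fst).add (hP.1.comp measurable_snd),
    fun z => add_nonneg (hQ.2.1 _) (hP.2.1 _), fun t ht => ?_⟩
  simp only [mul_add, Real.exp_add]
  refine ⟨(hQ.2.2 t ht).1.mul_prod (hP.2.2 t ht).1, ?_⟩
  rw [Real.rpow_add (div_pos Real.pi_pos ht), ← (hQ.2.2 t ht).2, ← (hP.2.2 t ht).2]
  exact integral_prod_mul (fun z => Real.exp (-t * Q z)) fun w => Real.exp (-t * P w)

lemma integrableOn_cpow_mul_exp_neg_mul {a : ℂ} {r : ℝ} (ha : 0 < a.re) (hr : 0 < r) :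
    IntegrableOn (fun t : ℝ => (t : ℂ) ^ (a - 1) * Complex.exp (-(r * t))) (Set.Ioi 0) := by
  -- a non-integrable function has integral `0`, whereas the Gamma integral does not vanish
  by_contra h
  have h2 := Complex.integral_cpow_mul_exp_neg_mul_Ioi ha hr
  rw [integral_undef h, eq_comm, mul_eq_zero] at h2
  rcases h2 with h2 | h2
  · rw [Complex.cpow_eq_zero_iff] at h2
    simp [hr.ne'] at h2
  · exact Complex.Gamma_ne_zero_of_re_pos ha h2

/-- The integrand `s ^ (a - 1) (1 + s + Q) ^ (-σ)` on `s > 0`, extended by zero. -/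
noncomputable def model {Z : Type*} (Q : Z → ℝ) (a σ : ℂ) (z : Z × ℝ) : ℂ :=
  if 0 < z.2 then (z.2 : ℂ) ^ (a - 1) * ((1 + z.2 + Q z.1 : ℝ) : ℂ) ^ (-σ) else 0

/-- Writing `Γ(σ) (1 + s + Q) ^ (-σ) = ∫ t ^ (σ - 1) exp (-t (1 + s + Q)) dt` and integrating
first over the Gaussian variables and `s`, then over `t`, gives only Gamma integrals. -/
lemma integrable_model_and_integral {Z : Type*} [MeasureSpace Z] [SFinite (volume : Measure Z)]
    {Q : Z → ℝ} {d : ℝ} (hQ : IsGaussianForm Q d) {a σ : ℂ} (ha : 0 < a.re)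
    (hσa : 0 < (σ - a - d).re) (hσ : 0 < σ.re) :
    Integrable (model Q a σ) ∧
      ∫ z, model Q a σ z =
        (Real.pi : ℂ) ^ (d : ℂ) * (Complex.Gamma a * Complex.Gamma (σ - a - d) /
          Complex.Gamma σ) := by
  obtain ⟨hQm, hQ0, hQi⟩ := hQ
  let μ : Measure ℝ := volume.restrict (Set.Ioi 0)
  let ν : Measure (Z × ℝ) := volume.prod μ
  let F : ℝ × (Z × ℝ) → ℂ := fun x =>
    (x.1 : ℂ) ^ (σ - 1) * Complex.exp (-x.1) *
      ((Real.exp (-x.1 * Q x.2.1) : ℂ) *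
        ((x.2.2 : ℂ) ^ (a - 1) * Complex.exp (-(x.1 * x.2.2))))
  have hFm : Measurable F := by
    have := hQm
    fun_prop
  have hμ : ∀ᵐ t ∂μ, 0 < t := ae_restrict_mem measurableSet_Ioi
  have hsec : ∀ t : ℝ, 0 < t → Integrable (fun y => F (t, y)) ν := fun t ht =>
    ((hQi t ht).1.ofReal.mul_prod (integrableOn_cpow_mul_exp_neg_mul ha ht)).const_mul
      ((t : ℂ) ^ (σ - 1) * Complex.exp (-t))
  have hval : ∀ t : ℝ, 0 < t → ∫ y, F (t, y) ∂ν =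
      (Real.pi : ℂ) ^ (d : ℂ) * Complex.Gamma a *
        ((t : ℂ) ^ ((σ - a - d) - 1) * Complex.exp (-((1 : ℝ) * t))) := by
    intro t ht
    have ht' : (t : ℂ) ≠ 0 := by exact_mod_cast ht.ne'
    simp only [F]
    rw [integral_const_mul, integral_prod_mul (fun z => (Real.exp (-t * Q z) : ℂ))
      (fun s : ℝ => (s : ℂ) ^ (a - 1) * Complex.exp (-(t * s))), integral_complex_ofReal,
      (hQi t ht).2, Complex.integral_cpow_mul_exp_neg_mul_Ioi ha ht,
      Complex.ofReal_cpow (div_pos Real.pi_pos ht).le, Complex.ofReal_div,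
      Complex.div_cpow_ofReal_nonneg Real.pi_pos.le ht.le,
      show σ - a - (d : ℂ) - 1 = (σ - 1) - a - d by ring, one_div, Complex.inv_cpow]
    · simp only [Complex.cpow_sub _ _ ht', Complex.ofReal_one, one_mul]
      ring
    · rw [Complex.arg_ofReal_of_nonneg ht.le]
      exact Real.pi_pos.ne
  have hnorm : ∀ t : ℝ, 0 < t → ∫ y, ‖F (t, y)‖ ∂ν =
      ‖(t : ℂ) ^ ((σ - a - d) - 1) * Complex.exp (-((1 : ℝ) * t))‖ *
        (Real.pi ^ d * Real.Gamma a.re) := by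
    intro t ht
    have h1 : ∀ y : Z × ℝ, ‖F (t, y)‖ = ‖(t : ℂ) ^ (σ - 1) * Complex.exp (-t)‖ *
        (Real.exp (-t * Q y.1) * ‖(y.2 : ℂ) ^ (a - 1) * Complex.exp (-(t * y.2))‖) := by
      intro y
      simp only [F, norm_mul, Complex.norm_real, Real.norm_eq_abs, Real.abs_exp]
    have h2 : ∫ s, ‖(s : ℂ) ^ (a - 1) * Complex.exp (-(t * s))‖ ∂μ =
        (1 / t) ^ a.re * Real.Gamma a.re := by
      rw [← Real.integral_rpow_mul_exp_neg_mul_Ioi ha ht]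
      refine setIntegral_congr_fun measurableSet_Ioi fun s hs => ?_
      simp only [norm_mul, Complex.norm_cpow_eq_rpow_re_of_pos hs, Complex.norm_exp]
      simp
    simp_rw [h1]
    rw [integral_const_mul, integral_prod_mul (fun z => Real.exp (-t * Q z))
      (fun s : ℝ => ‖(s : ℂ) ^ (a - 1) * Complex.exp (-(t * s))‖), (hQi t ht).2, h2,
      norm_mul, norm_mul, Complex.norm_cpow_eq_rpow_re_of_pos ht,
      Complex.norm_cpow_eq_rpow_re_of_pos ht,
      show (σ - a - (d : ℂ) - 1).re = (σ - 1).re - a.re - d by simp; ring,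
      Real.rpow_sub ht, Real.rpow_sub ht, Real.div_rpow Real.pi_pos.le ht.le,
      Real.div_rpow zero_le_one ht.le, Real.one_rpow]
    simp only [Complex.ofReal_one, one_mul]
    ring
  have hFi : Integrable F (μ.prod ν) := by
    rw [integrable_prod_iff hFm.aestronglyMeasurable]
    refine ⟨hμ.mono fun t ht => hsec t ht, ?_⟩
    refine (((integrableOn_cpow_mul_exp_neg_mul hσa one_pos).norm).mul_const
      (Real.pi ^ d * Real.Gamma a.re)).congr ?_
    exact hμ.mono fun t ht => (hnorm t ht).symm
  have hν : ν = (volume : Measure (Z × ℝ)).restrict {z | 0 < z.2} := by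
    have : {z : Z × ℝ | 0 < z.2} = Set.univ ×ˢ Set.Ioi 0 := by ext; simp
    rw [this, Measure.volume_eq_prod, ← Measure.prod_restrict, Measure.restrict_univ]
  have hmeas : MeasurableSet {z : Z × ℝ | 0 < z.2} :=
    measurableSet_lt measurable_const measurable_snd
  have hin : ∀ y : Z × ℝ, 0 < y.2 → ∫ t, F (t, y) ∂μ = Complex.Gamma σ *
      ((y.2 : ℂ) ^ (a - 1) * ((1 + y.2 + Q y.1 : ℝ) : ℂ) ^ (-σ)) := by
    intro y hy
    have hr : 0 < 1 + y.2 + Q y.1 := by linarith [hQ0 y.1]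
    have h1 : ∀ t : ℝ, F (t, y) = (y.2 : ℂ) ^ (a - 1) * ((t : ℂ) ^ (σ - 1) *
        Complex.exp (-((1 + y.2 + Q y.1 : ℝ) * t))) := by
      intro t
      simp only [F]
      have : Complex.exp (-((1 + y.2 + Q y.1 : ℝ) * t)) = Complex.exp (-t) *
          Complex.exp (-t * Q y.1) * Complex.exp (-(t * y.2)) := by
        rw [← Complex.exp_add, ← Complex.exp_add]
        congr 1
        push_cast
        ring
      rw [this]
      push_cast
      ring
    simp_rw [h1]
    rw [integral_const_mul, Complex.integral_cpow_mul_exp_neg_mul_Ioi hσ hr, one_div,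
      Complex.inv_cpow, Complex.cpow_neg]
    · ring
    · rw [Complex.arg_ofReal_of_nonneg hr.le]
      exact Real.pi_pos.ne
  have hΓ : Complex.Gamma σ ≠ 0 := Complex.Gamma_ne_zero_of_re_pos hσ
  have hmodel : model Q a σ = Set.indicator {z | 0 < z.2} fun y =>
      (Complex.Gamma σ)⁻¹ * ∫ t, F (t, y) ∂μ := by
    funext y
    by_cases hy : 0 < y.2
    · rw [Set.indicator_of_mem (by exact hy), hin y hy, inv_mul_cancel_left₀ hΓ, model, if_pos hy]
    · rw [Set.indicator_of_notMem (by exact hy), model, if_neg hy]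
  rw [hmodel, integrable_indicator_iff hmeas, integral_indicator hmeas, IntegrableOn, ← hν]
  refine ⟨hFi.integral_prod_right.const_mul _, ?_⟩
  rw [integral_const_mul, ← integral_prod_symm _ hFi, integral_prod _ hFi,
    integral_congr_ae (hμ.mono fun t ht => hval t ht), integral_const_mul,
    Complex.integral_cpow_mul_exp_neg_mul_Ioi hσa one_pos]
  simp only [Complex.ofReal_one, div_one, Complex.one_cpow]
  field_simp

/-! ### Splitting off the last row and column -/

/-- The measurable version of `Equiv.prodProdProdComm`. -/
def prodProdProdCommEquiv {α β γ δ : Type*} [MeasurableSpace α] [MeasurableSpace β]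
    [MeasurableSpace γ] [MeasurableSpace δ] : (α × β) × (γ × δ) ≃ᵐ (α × γ) × (β × δ) where
  toEquiv := Equiv.prodProdProdComm α β γ δ
  measurable_toFun := by
    change Measurable fun x : (α × β) × (γ × δ) => ((x.1.1, x.2.1), (x.1.2, x.2.2))
    fun_prop
  measurable_invFun := by
    change Measurable fun x : (α × γ) × (β × δ) => ((x.1.1, x.2.1), (x.1.2, x.2.2))
    fun_prop

lemma measurePreserving_prodProdProdCommEquiv {α β γ δ : Type*} [MeasureSpace α] [MeasureSpace β]
    [MeasureSpace γ] [MeasureSpace δ] [SFinite (volume : Measure α)]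
    [SFinite (volume : Measure β)] [SFinite (volume : Measure γ)]
    [SFinite (volume : Measure δ)] :
    MeasurePreserving (prodProdProdCommEquiv : (α × β) × (γ × δ) ≃ᵐ _) := by
  have h1 : MeasurePreserving (MeasurableEquiv.prodAssoc : (α × β) × (γ × δ) ≃ᵐ _) :=
    measurePreserving_prodAssoc _ _ _
  have h2 : MeasurePreserving (MeasurableEquiv.prodAssoc.symm : β × (γ × δ) ≃ᵐ _) :=
    (measurePreserving_prodAssoc _ _ _).symm
  have h3 : MeasurePreserving (Prod.map Prod.swap id : (β × γ) × δ → (γ × β) × δ) :=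
    Measure.measurePreserving_swap.prod (.id _)
  have h4 : MeasurePreserving (MeasurableEquiv.prodAssoc : (γ × β) × δ ≃ᵐ _) :=
    measurePreserving_prodAssoc _ _ _
  have h5 : MeasurePreserving (Prod.map id (MeasurableEquiv.prodAssoc ∘
      (Prod.map Prod.swap id : (β × γ) × δ → (γ × β) × δ) ∘ MeasurableEquiv.prodAssoc.symm) :
      α × (β × (γ × δ)) → α × (γ × (β × δ))) :=
    (MeasurePreserving.id _).prod (h4.comp (h3.comp h2))
  have h6 : MeasurePreserving (MeasurableEquiv.prodAssoc.symm : α × (γ × (β × δ)) ≃ᵐ _) :=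
    (measurePreserving_prodAssoc _ _ _).symm
  exact h6.comp (h5.comp h1)

/-- The coordinates in the last row and column of `L`, `M` and `N`: the last row of `L`, the last
column of `M` without its last entry, that entry, and the last column of `N`. -/
abbrev LastCoords (m p : ℕ) : Type :=
  (Fin m → ℝ) × (((Fin p → ℝ) × ℝ) × (Fin p → ℝ))

/-- The pairs `i ≤ j` in `Fin (p + 1)`: those in `Fin p`, and those with `j` last. -/
noncomputable def leIndexEquiv (p : ℕ) : {ij : Fin p × Fin p // ij.1 ≤ ij.2} ⊕ (Fin p ⊕ Unit) ≃
    {ij : Fin (p + 1) × Fin (p + 1) // ij.1 ≤ ij.2} :=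
  Equiv.ofBijective
    (Sum.elim (fun ij => ⟨(ij.1.1.castSucc, ij.1.2.castSucc), ij.2⟩)
      (Sum.elim (fun i => ⟨(i.castSucc, Fin.last p), Fin.le_last _⟩)
        fun _ => ⟨(Fin.last p, Fin.last p), le_rfl⟩)) (by
    constructor
    · rintro (⟨⟨i, j⟩, h⟩ | i | _) (⟨⟨i', j'⟩, h'⟩ | i' | _) e <;>
        simp_all [Fin.ext_iff] <;> omega
    · rintro ⟨⟨i, j⟩, h⟩
      induction j using Fin.lastCases with
      | last =>
        induction i using Fin.lastCases with
        | last => exact ⟨.inr (.inr ()), rfl⟩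
        | cast i => exact ⟨.inr (.inl i), rfl⟩
      | cast j =>
        have hi : (i : ℕ) < p := lt_of_le_of_lt h j.2
        exact ⟨.inl ⟨(⟨i, hi⟩, j), h⟩, rfl⟩)

/-- The pairs `i < j` in `Fin (p + 1)`: those in `Fin p`, and those with `j` last. -/
noncomputable def ltIndexEquiv (p : ℕ) : {ij : Fin p × Fin p // ij.1 < ij.2} ⊕ Fin p ≃
    {ij : Fin (p + 1) × Fin (p + 1) // ij.1 < ij.2} :=
  Equiv.ofBijective
    (Sum.elim (fun ij => ⟨(ij.1.1.castSucc, ij.1.2.castSucc), ij.2⟩)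
      (fun i => ⟨(i.castSucc, Fin.last p), Fin.castSucc_lt_last i⟩)) (by
    constructor
    · rintro (⟨⟨i, j⟩, h⟩ | i) (⟨⟨i', j'⟩, h'⟩ | i') e <;>
        simp_all [Fin.ext_iff] <;> omega
    · rintro ⟨⟨i, j⟩, h⟩
      induction j using Fin.lastCases with
      | last => exact ⟨.inr ⟨i, h⟩, rfl⟩
      | cast j =>
        have hi : (i : ℕ) < p := lt_trans h j.2
        exact ⟨.inl ⟨(⟨i, hi⟩, j), h⟩, rfl⟩)

/-- Pulling a family back along `κ ⊕ κ' ≃ ι` and splitting it. -/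
def splitEquiv (E : Type*) [MeasurableSpace E] {ι κ κ' : Type*} (e : κ ⊕ κ' ≃ ι) :
    (ι → E) ≃ᵐ (κ → E) × (κ' → E) :=
  (MeasurableEquiv.piCongrLeft (fun _ : ι => E) e).symm.trans
    (MeasurableEquiv.sumPiEquivProdPi fun _ : κ ⊕ κ' => E)

lemma measurePreserving_splitEquiv (E : Type*) [MeasureSpace E] [SigmaFinite (volume : Measure E)]
    {ι κ κ' : Type*} [Fintype ι] [Fintype κ] [Fintype κ'] (e : κ ⊕ κ' ≃ ι) :
    MeasurePreserving (splitEquiv E e) :=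
  (volume_measurePreserving_piCongrLeft (fun _ : ι => E) e).symm.trans
    (volume_measurePreserving_sumPiEquivProdPi fun _ : κ ⊕ κ' => E)

/-- `splitEquiv` with a single index in the second part. -/
def splitLastEquiv (E : Type*) [MeasurableSpace E] {ι κ κ' : Type*} [Unique κ']
    (e : κ ⊕ κ' ≃ ι) : (ι → E) ≃ᵐ (κ → E) × E :=
  (splitEquiv E e).trans
    (MeasurableEquiv.prodCongr (.refl _) (MeasurableEquiv.funUnique κ' E))

lemma measurePreserving_splitLastEquiv (E : Type*) [MeasureSpace E]
    [SigmaFinite (volume : Measure E)] {ι κ κ' : Type*} [Fintype ι] [Fintype κ] [Unique κ']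
    (e : κ ⊕ κ' ≃ ι) : MeasurePreserving (splitLastEquiv E e) :=
  (measurePreserving_splitEquiv E e).trans
    ((MeasurePreserving.id _).prod (volume_preserving_funUnique κ' E))

/-- The coordinates of the left upper blocks of `L`, `M`, `N`, and those in the last row and
column. -/
def restrictCoords {m p : ℕ} (x : Coords m (p + 1)) : Coords m p × LastCoords m p :=
  ((fun i => x.1 i.castSucc,
      fun ij => x.2.1 ⟨(ij.1.1.castSucc, ij.1.2.castSucc), ij.2⟩,
      fun ij => x.2.2 ⟨(ij.1.1.castSucc, ij.1.2.castSucc), ij.2⟩),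
    x.1 (Fin.last p),
    (fun i => x.2.1 ⟨(i.castSucc, Fin.last p), Fin.le_last _⟩,
      x.2.1 ⟨(Fin.last p, Fin.last p), le_rfl⟩),
    fun i => x.2.2 ⟨(i.castSucc, Fin.last p), Fin.castSucc_lt_last i⟩)

/-- Splitting off the last row and column permutes coordinates, so it preserves the volume. -/
lemma exists_coordsEquiv (m p : ℕ) :
    ∃ e : Coords m (p + 1) ≃ᵐ Coords m p × LastCoords m p,
      MeasurePreserving e ∧ ∀ x, e x = restrictCoords x := by
  let eL := splitLastEquiv (Fin m → ℝ) (finSumFinEquiv (m := p) (n := 1))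
  have hL : MeasurePreserving eL := measurePreserving_splitLastEquiv _ _
  let eM' := splitLastEquiv ℝ (Equiv.refl (Fin p ⊕ Unit))
  have hM' : MeasurePreserving eM' := measurePreserving_splitLastEquiv _ _
  let eM := (splitEquiv ℝ (leIndexEquiv p)).trans (MeasurableEquiv.prodCongr (.refl _) eM')
  have hM : MeasurePreserving eM :=
    (measurePreserving_splitEquiv _ _).trans ((MeasurePreserving.id _).prod hM')
  let eN := splitEquiv ℝ (ltIndexEquiv p)
  have hN : MeasurePreserving eN := measurePreserving_splitEquiv _ _
  let eMN := (MeasurableEquiv.prodCongr eM eN).trans prodProdProdCommEquiv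
  have hMN : MeasurePreserving eMN :=
    (hM.prod hN).trans measurePreserving_prodProdProdCommEquiv
  exact ⟨(MeasurableEquiv.prodCongr eL eMN).trans prodProdProdCommEquiv,
    (hL.prod hMN).trans measurePreserving_prodProdProdCommEquiv, fun x => rfl⟩

section Entries

variable {m p : ℕ} (x : Coords m (p + 1))

/-- The coordinates of the left upper blocks. -/
abbrev head : Coords m p := (restrictCoords x).1

lemma matL_castSucc (i : Fin p) (j : Fin m) : matL x i.castSucc j = matL (head x) i j := rfl

lemma matM_castSucc (i j : Fin p) : matM x i.castSucc j.castSucc = matM (head x) i j := by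
  simp only [matM, Matrix.of_apply, Fin.castSucc_le_castSucc_iff]
  rfl

lemma matN_castSucc (i j : Fin p) : matN x i.castSucc j.castSucc = matN (head x) i j := by
  simp only [matN, Matrix.of_apply, Fin.castSucc_lt_castSucc_iff]
  rfl

lemma matM_castSucc_last (i : Fin p) :
    matM x i.castSucc (Fin.last p) = (restrictCoords x).2.2.1.1 i := by
  simp only [matM, Matrix.of_apply, Fin.le_last, dite_true]
  rfl

lemma matM_last_castSucc (i : Fin p) :
    matM x (Fin.last p) i.castSucc = (restrictCoords x).2.2.1.1 i := by
  simp only [matM, Matrix.of_apply, not_le.2 (Fin.castSucc_lt_last i), dite_false]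
  rfl

lemma matM_last_last : matM x (Fin.last p) (Fin.last p) = (restrictCoords x).2.2.1.2 := by
  simp only [matM, Matrix.of_apply, le_rfl, dite_true]
  rfl

lemma matN_castSucc_last (i : Fin p) :
    matN x i.castSucc (Fin.last p) = (restrictCoords x).2.2.2 i := by
  simp only [matN, Matrix.of_apply, Fin.castSucc_lt_last i, dite_true]
  rfl

lemma matN_last_castSucc (i : Fin p) :
    matN x (Fin.last p) i.castSucc = -(restrictCoords x).2.2.2 i := by
  simp only [matN, Matrix.of_apply, Fin.castSucc_lt_last i, (Fin.castSucc_lt_last i).not_gt,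
    dite_true, dite_false]
  rfl

lemma matN_last_last : matN x (Fin.last p) (Fin.last p) = 0 := by
  simp [matN]

end Entries

lemma matM_transpose {m p : ℕ} (x : Coords m p) : (matM x).transpose = matM x := by
  ext i j
  simp only [matM, Matrix.transpose_apply, Matrix.of_apply]
  rcases lt_trichotomy i j with h | rfl | h
  · simp [h.le, not_le.2 h]
  · rfl
  · simp [h.le, not_le.2 h]

lemma matN_transpose {m p : ℕ} (x : Coords m p) : (matN x).transpose = -matN x := by
  ext i j
  simp only [matN, Matrix.transpose_apply, Matrix.of_apply, Matrix.neg_apply]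
  rcases lt_trichotomy i j with h | rfl | h
  · simp [h, h.not_gt]
  · simp
  · simp [h, h.not_gt]

/-- The Schur complement `M - L Lᵗ` of the identity block in `(1 Lᵗ; L M)`. -/
def schur {m p : ℕ} (x : Coords m p) : Matrix (Fin p) (Fin p) ℝ :=
  matM x - matL x * (matL x).transpose

/-- The matrix `1 + M + N`. -/
def shifted {m p : ℕ} (x : Coords m p) : Matrix (Fin p) (Fin p) ℝ :=
  1 + matM x + matN x

lemma schur_isHermitian {m p : ℕ} (x : Coords m p) : (schur x).IsHermitian := by
  rw [Matrix.IsHermitian, Matrix.conjTranspose_eq_transpose_of_trivial, schur,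
    Matrix.transpose_sub, Matrix.transpose_mul, Matrix.transpose_transpose, matM_transpose]

lemma schur_submatrix {m p : ℕ} (x : Coords m (p + 1)) :
    (schur x).submatrix Fin.castSucc Fin.castSucc = schur (head x) := by
  ext i j
  simp only [schur, Matrix.submatrix_apply, Matrix.sub_apply, Matrix.mul_apply,
    Matrix.transpose_apply, matM_castSucc, matL_castSucc]

lemma shifted_submatrix {m p : ℕ} (x : Coords m (p + 1)) :
    (shifted x).submatrix Fin.castSucc Fin.castSucc = shifted (head x) := by
  ext i j
  simp only [shifted, Matrix.submatrix_apply, Matrix.add_apply, matM_castSucc, matN_castSucc,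
    Matrix.one_apply, Fin.castSucc_inj]

lemma shifted_det_pos {m p : ℕ} {x : Coords m p} (h : (schur x).PosDef) :
    0 < (shifted x).det := by
  apply det_pos_of_add_transpose_posDef
  have e : shifted x + (shifted x).transpose = (2 : ℝ) • (1 + (schur x +
      matL x * (matL x).transpose)) := by
    rw [shifted, Matrix.transpose_add, Matrix.transpose_add, Matrix.transpose_one,
      matM_transpose, matN_transpose, schur]
    module
  rw [e]
  refine (Matrix.PosDef.one.add_posSemidef (h.posSemidef.add ?_)).smul two_pos
  simpa using Matrix.posSemidef_self_mul_conjTranspose (matL x)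

/-! ### Coordinates on the fibres of the projection to the left upper blocks -/

/-- The space of the variables `(w, l', v)` that enter the model integrand quadratically. -/
abbrev QuadSpace (m p : ℕ) : Type := (Fin p → ℝ) × ((Fin m → ℝ) × (Fin p → ℝ))

/-- The sum of the squares of the coordinates of `(w, l', v)`. -/
def sumSq {m p : ℕ} (z : QuadSpace m p) : ℝ :=
  ∑ i, z.1 i ^ 2 + (∑ i, z.2.1 i ^ 2 + ∑ i, z.2.2 i ^ 2)

/-- A parametrization of the last row and column over given left upper blocks `L`, `M`, `N`.
With `S = M - L Lᵗ`, `A = 1 + M + N` and `Eᵗ S E = 1`, the variables are chosen such that the last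
column of `1 + M + N` is `A w` up to its last entry, the last column of the new `M - L Lᵗ` is
`S (w + E v)` up to its last entry, and `s` is the Schur complement of `S` in the latter matrix. -/
def fibreMap {m p : ℕ} (x : Coords m p) (E : Matrix (Fin p) (Fin p) ℝ)
    (z : QuadSpace m p × ℝ) : LastCoords m p :=
  let w := z.1.1
  let l := z.1.2.1 + (matL x)ᵀ *ᵥ w
  let r := w + E *ᵥ z.1.2.2
  let b := schur x *ᵥ r + matL x *ᵥ l
  (l, ((b, z.2 + (l ⬝ᵥ l + r ⬝ᵥ schur x *ᵥ r)), shifted x *ᵥ w - b))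

section Determinants

variable {m p : ℕ} {X : Coords m (p + 1)} {x : Coords m p} {E : Matrix (Fin p) (Fin p) ℝ}
  {z : QuadSpace m p × ℝ}

lemma schur_det_of_restrictCoords (hX : restrictCoords X = (x, fibreMap x E z))
    (hS : (schur x).det ≠ 0) : (schur X).det = (schur x).det * z.2 := by
  have hx : head X = x := congrArg Prod.fst hX
  have hl : (restrictCoords X).2 = fibreMap x E z := congrArg Prod.snd hX
  have hsub := schur_submatrix X
  have hrow : ∀ j, matL X (Fin.last p) j = (fibreMap x E z).1 j := fun j => by rw [← hl]; rfl
  have hcol : ∀ i : Fin p, schur X i.castSucc (Fin.last p) =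
      (schur x *ᵥ (z.1.1 + E *ᵥ z.1.2.2)) i := by
    intro i
    simp only [schur, Matrix.sub_apply, Matrix.mul_apply, Matrix.transpose_apply,
      matM_castSucc_last, matL_castSucc, hrow, hl, hx]
    simp only [fibreMap, Pi.add_apply, schur]
    rw [add_sub_assoc, add_eq_left, sub_eq_zero]
    rfl
  have hrow' : (fun i : Fin p => schur X (Fin.last p) i.castSucc) =
      schur x *ᵥ (z.1.1 + E *ᵥ z.1.2.2) := by
    funext i
    rw [← hcol, ← (schur_isHermitian X).apply, star_trivial]
  rw [det_succ_of_mulVec (schur X) (by rwa [hsub, hx]) (z.1.1 + E *ᵥ z.1.2.2)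
    (by rw [hsub, hx]; exact hcol), hsub, hx, hrow']
  congr 1
  simp only [schur, Matrix.sub_apply, Matrix.mul_apply, Matrix.transpose_apply,
      matM_last_last, hrow, hl]
  simp only [fibreMap]
  rw [dotProduct_comm (_ *ᵥ _)]
  simp only [dotProduct, schur]
  ring

lemma shifted_det_of_restrictCoords (hX : restrictCoords X = (x, fibreMap x E z))
    (hA : (shifted x).det ≠ 0) (hE : Eᵀ * schur x * E = 1) :
    (shifted X).det = (shifted x).det * (1 + z.2 + sumSq z.1) := by
  have hx : head X = x := congrArg Prod.fst hX
  have hl : (restrictCoords X).2 = fibreMap x E z := congrArg Prod.snd hX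
  have hsub := shifted_submatrix X
  have hcol : ∀ i : Fin p, shifted X i.castSucc (Fin.last p) = (shifted x *ᵥ z.1.1) i := by
    intro i
    simp only [shifted, Matrix.add_apply, matM_castSucc_last, matN_castSucc_last, hl,
      Matrix.one_apply_ne (Fin.castSucc_lt_last i).ne]
    simp only [fibreMap, Pi.sub_apply, Pi.add_apply, shifted]
    ring
  have hrow : (fun i : Fin p => shifted X (Fin.last p) i.castSucc) =
      (2 : ℝ) • (fibreMap x E z).2.1.1 - shifted x *ᵥ z.1.1 := by
    funext i
    simp only [shifted, Matrix.add_apply, matM_last_castSucc, matN_last_castSucc, hl,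
      Matrix.one_apply_ne (Fin.castSucc_lt_last i).ne']
    simp only [fibreMap, Pi.sub_apply, Pi.add_apply, Pi.smul_apply, smul_eq_mul, shifted]
    ring
  have hcorner : shifted X (Fin.last p) (Fin.last p) = 1 + (fibreMap x E z).2.1.2 := by
    simp only [shifted, Matrix.add_apply, matM_last_last, matN_last_last, hl, Matrix.one_apply_eq,
      add_zero]
  rw [det_succ_of_mulVec (shifted X) (by rwa [hsub, hx]) z.1.1
    (by rw [hsub, hx]; exact hcol), hsub, hx, hrow, hcorner]
  congr 1
  obtain ⟨⟨w, l, v⟩, s⟩ := z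
  simp only [fibreMap, sumSq]
  set S := schur x with hSdef
  set L := matL x with hLdef
  set u := Lᵀ *ᵥ w with hu
  set y := E *ᵥ v with hy
  have hST : Sᵀ = S := schur_isHermitian x
  have h1 : ∀ a, (L *ᵥ a) ⬝ᵥ w = a ⬝ᵥ u := fun a => by
    rw [hu, Matrix.mulVec_transpose, dotProduct_comm a, ← Matrix.dotProduct_mulVec,
      dotProduct_comm]
  have h2 : ∀ a b, (S *ᵥ a) ⬝ᵥ b = a ⬝ᵥ (S *ᵥ b) := fun a b => by
    rw [Matrix.dotProduct_mulVec, ← Matrix.mulVec_transpose, hST]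
  have h3 : y ⬝ᵥ (S *ᵥ y) = v ⬝ᵥ v := by
    rw [hy, Matrix.mulVec_mulVec, dotProduct_comm, Matrix.dotProduct_mulVec,
      ← Matrix.mulVec_transpose, Matrix.mulVec_mulVec, ← Matrix.mul_assoc, hE, Matrix.one_mulVec]
  have h4 : (shifted x *ᵥ w) ⬝ᵥ w = w ⬝ᵥ w + w ⬝ᵥ (S *ᵥ w) + u ⬝ᵥ u := by
    have hN : (matN x *ᵥ w) ⬝ᵥ w = 0 := by
      have : (matN x *ᵥ w) ⬝ᵥ w = -((matN x *ᵥ w) ⬝ᵥ w) := by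
        conv_lhs => rw [dotProduct_comm, Matrix.dotProduct_mulVec, ← Matrix.mulVec_transpose,
          matN_transpose, Matrix.neg_mulVec, neg_dotProduct]
      linarith
    have hM : matM x = S + L * Lᵀ := by rw [hSdef, hLdef, schur]; abel
    rw [shifted, Matrix.add_mulVec, Matrix.add_mulVec, Matrix.one_mulVec, add_dotProduct, hN, hM,
      Matrix.add_mulVec, ← Matrix.mulVec_mulVec, add_dotProduct, add_dotProduct, h1, h2]
    ring
  have h5 : y ⬝ᵥ (S *ᵥ w) = w ⬝ᵥ (S *ᵥ y) := by rw [← h2, dotProduct_comm]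
  simp only [sub_dotProduct, smul_dotProduct, add_dotProduct, dotProduct_add, h1, h2, h4,
    Matrix.mulVec_add, h3, h5, smul_eq_mul, dotProduct_comm u l]
  simp only [dotProduct, ← sq]
  ring

end Determinants

/-! ### The Jacobian of the fibre coordinates -/

lemma measurePreserving_mulVec {n : ℕ} {A : Matrix (Fin n) (Fin n) ℝ} (hA : A.det ≠ 0) :
    MeasurePreserving (fun v : Fin n → ℝ => A *ᵥ v)
      (ENNReal.ofReal |A.det| • volume) volume := by
  refine ⟨by fun_prop, ?_⟩
  have h := Real.map_matrix_volume_pi_eq_smul_volume_pi hA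
  rw [Measure.map_smul]
  change _ • Measure.map (⇑(Matrix.toLin' A)) volume = _
  rw [h, smul_smul, ← ENNReal.ofReal_mul (abs_nonneg _), ← abs_mul, mul_inv_cancel₀ hA]
  simp


lemma measurePreserving_fibreMap {m p : ℕ} (x : Coords m p) (E : Matrix (Fin p) (Fin p) ℝ)
    (hA : (shifted x).det ≠ 0) (hE : (schur x * E).det ≠ 0) :
    MeasurePreserving (fibreMap x E)
      (ENNReal.ofReal (|(shifted x).det| * |(schur x * E).det|) • volume) volume := by
  set kA := ENNReal.ofReal |(shifted x).det|
  set kE := ENNReal.ofReal |(schur x * E).det|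
  -- for fixed `w` and `l`, the vector `b` is a translate of `S E v`
  have hb : ∀ (w : Fin p → ℝ) (l : Fin m → ℝ), MeasurePreserving
      (fun v : Fin p → ℝ => schur x *ᵥ (w + E *ᵥ v) + matL x *ᵥ l) (kE • volume) volume := by
    intro w l
    have h := (measurePreserving_add_right volume (schur x *ᵥ w + matL x *ᵥ l)).comp
      (measurePreserving_mulVec hE)
    convert h using 1
    funext v
    simp only [Function.comp_apply, Matrix.mulVec_add, ← Matrix.mulVec_mulVec]
    abel
  have hlb : ∀ w : Fin p → ℝ, MeasurePreserving
      (fun y : (Fin m → ℝ) × (Fin p → ℝ) => (y.1 + (matL x)ᵀ *ᵥ w,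
        schur x *ᵥ (w + E *ᵥ y.2) + matL x *ᵥ (y.1 + (matL x)ᵀ *ᵥ w)))
      (volume.prod (kE • volume)) (volume.prod volume) := by
    intro w
    refine (measurePreserving_add_right volume ((matL x)ᵀ *ᵥ w)).skew_product
      (g := fun l v => schur x *ᵥ (w + E *ᵥ v) + matL x *ᵥ (l + (matL x)ᵀ *ᵥ w)) ?_
      (.of_forall fun l => (hb w _).map_eq)
    simp only [Function.uncurry_def]
    fun_prop
  have hxlb : MeasurePreserving
      (fun y : QuadSpace m p => (shifted x *ᵥ y.1, (y.2.1 + (matL x)ᵀ *ᵥ y.1,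
        schur x *ᵥ (y.1 + E *ᵥ y.2.2) + matL x *ᵥ (y.2.1 + (matL x)ᵀ *ᵥ y.1))))
      ((kA • volume).prod (volume.prod (kE • volume))) (volume.prod (volume.prod volume)) := by
    refine (measurePreserving_mulVec hA).skew_product
      (g := fun w (y : (Fin m → ℝ) × (Fin p → ℝ)) => (y.1 + (matL x)ᵀ *ᵥ w,
        schur x *ᵥ (w + E *ᵥ y.2) + matL x *ᵥ (y.1 + (matL x)ᵀ *ᵥ w))) ?_
      (.of_forall fun w => (hlb w).map_eq)
    simp only [Function.uncurry_def]
    fun_prop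
  have hshear : MeasurePreserving (fun y : ((Fin m → ℝ) × (Fin p → ℝ)) × (Fin p → ℝ) =>
      (y.1, y.2 - y.1.2)) (volume.prod volume) (volume.prod volume) := by
    refine (MeasurePreserving.id _).skew_product
      (g := fun (y : (Fin m → ℝ) × (Fin p → ℝ)) (a : Fin p → ℝ) => a - y.2)
      (by simp only [Function.uncurry_def]; fun_prop)
      (.of_forall fun y => (measurePreserving_sub_right volume y.2).map_eq)
  have hquad := hshear.comp ((Measure.measurePreserving_swap).comp hxlb)
  have hc := hquad.skew_product (μc := (volume : Measure ℝ)) (μd := volume)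
    (g := fun (y : QuadSpace m p) s => s + ((y.2.1 + (matL x)ᵀ *ᵥ y.1) ⬝ᵥ
        (y.2.1 + (matL x)ᵀ *ᵥ y.1) + (y.1 + E *ᵥ y.2.2) ⬝ᵥ schur x *ᵥ (y.1 + E *ᵥ y.2.2)))
    (by simp only [Function.uncurry_def, dotProduct]; fun_prop)
    (.of_forall fun y => (measurePreserving_add_right volume _).map_eq)
  -- regroup `(((l, b), n), c)` as `(l, ((b, c), n))`
  have hre : MeasurePreserving
      (fun y : (((Fin m → ℝ) × (Fin p → ℝ)) × (Fin p → ℝ)) × ℝ =>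
        ((y.1.1.1, ((y.1.1.2, y.2), y.1.2)) : LastCoords m p)) := by
    have h1 : MeasurePreserving (MeasurableEquiv.prodAssoc :
      (((Fin m → ℝ) × (Fin p → ℝ)) × (Fin p → ℝ)) × ℝ ≃ᵐ _) := measurePreserving_prodAssoc _ _ _
    have h2 : MeasurePreserving (Prod.map id Prod.swap :
      ((Fin m → ℝ) × (Fin p → ℝ)) × ((Fin p → ℝ) × ℝ) → _ × (ℝ × (Fin p → ℝ))) :=
      (MeasurePreserving.id _).prod Measure.measurePreserving_swap
    have h3 : MeasurePreserving (MeasurableEquiv.prodAssoc :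
      ((Fin m → ℝ) × (Fin p → ℝ)) × (ℝ × (Fin p → ℝ)) ≃ᵐ _) := measurePreserving_prodAssoc _ _ _
    have h4 : MeasurePreserving (MeasurableEquiv.prodAssoc.symm :
      (Fin p → ℝ) × (ℝ × (Fin p → ℝ)) ≃ᵐ _) := (measurePreserving_prodAssoc _ _ _).symm
    exact ((MeasurePreserving.id _).prod h4).comp (h3.comp (h2.comp h1))
  have h := hre.comp hc
  have hμ : ((kA • volume).prod ((volume : Measure (Fin m → ℝ)).prod
      (kE • (volume : Measure (Fin p → ℝ))))).prod (volume : Measure ℝ) =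
      ENNReal.ofReal (|(shifted x).det| * |(schur x * E).det|) •
        (volume : Measure (QuadSpace m p × ℝ)) := by
    rw [Measure.prod_smul_right, Measure.prod_smul_right, Measure.prod_smul_left,
      Measure.prod_smul_left, Measure.prod_smul_left, smul_smul, ENNReal.ofReal_mul (abs_nonneg _), mul_comm]
    rfl
  rw [hμ] at h
  exact h

/-! ### The two descriptions of the domain and of the integrand -/

lemma posDef_iff_posSemidef_and_det_ne_zero {n : Type*} [Fintype n] [DecidableEq n]
    {X : Matrix n n ℝ} : X.PosDef ↔ X.PosSemidef ∧ X.det ≠ 0 :=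
  ⟨fun h => ⟨h.posSemidef, h.det_pos.ne'⟩, fun h => h.1.posDef_iff_det_ne_zero.2 h.2⟩

lemma matR_add_transpose {m p : ℕ} (x : Coords m p) :
    matR x + (matR x)ᵀ = (2 : ℝ) • Matrix.fromBlocks 1 (matL x)ᵀ (matL x) (matM x) := by
  rw [matR, Matrix.fromBlocks_transpose, Matrix.fromBlocks_add, Matrix.fromBlocks_smul,
    Matrix.transpose_add, matM_transpose, matN_transpose, Matrix.transpose_one,
    Matrix.transpose_zero, Matrix.transpose_smul]
  congr 1 <;> module

lemma posDef_fromBlocks_iff {m p : ℕ} (x : Coords m p) :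
    (Matrix.fromBlocks 1 (matL x)ᵀ (matL x) (matM x)).PosDef ↔ (schur x).PosDef := by
  let _ : Invertible (1 : Matrix (Fin m) (Fin m) ℝ) := invertibleOne
  have h := Matrix.PosDef.fromBlocks₁₁ (matL x)ᵀ (matM x)
    (Matrix.PosDef.one (n := Fin m) (R := ℝ))
  rw [Matrix.conjTranspose_eq_transpose_of_trivial, Matrix.transpose_transpose, inv_one,
    Matrix.mul_one] at h
  rw [posDef_iff_posSemidef_and_det_ne_zero, posDef_iff_posSemidef_and_det_ne_zero, h,
    Matrix.det_fromBlocks_one₁₁]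
  rfl

lemma sectionDomain_eq (m p : ℕ) : sectionDomain m p = {x | (schur x).PosDef} := by
  ext x
  change _ ↔ (schur x).PosDef
  rw [← posDef_fromBlocks_iff]
  have h2 : ∀ X : Matrix (Fin m ⊕ Fin p) (Fin m ⊕ Fin p) ℝ,
      ((2 : ℝ) • X).PosDef ↔ X.PosDef := fun X =>
    ⟨fun h => by simpa using h.smul (a := (2 : ℝ)⁻¹) (by norm_num), fun h => h.smul two_pos⟩
  rw [← h2, ← matR_add_transpose]
  exact ⟨fun h => h.1, fun h => ⟨h, _, _, rfl⟩⟩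

lemma posDomain_eq (m p : ℕ) : posDomain m p = {x | (schur x).PosDef} := by
  ext x
  exact ⟨fun h => h.1, fun h => ⟨h, by rw [matN_transpose, neg_neg]⟩⟩

lemma minor_matBlock {m p : ℕ} (x : Coords m p) (j : ℕ) :
    minor (matBlock x) (m + j) = minor (schur x) j := by
  let e : Fin m ⊕ {i : Fin p // (i : ℕ) < j} ≃ {i : Fin (m + p) // (i : ℕ) < m + j} :=
    Equiv.ofBijective (Sum.elim (fun i => ⟨Fin.castAdd p i, Nat.lt_add_right j i.2⟩)
      fun i => ⟨Fin.natAdd m i.1, Nat.add_lt_add_left i.2 m⟩) (by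
    constructor
    · rintro (i | ⟨i, hi⟩) (i' | ⟨i', hi'⟩) h <;> simp_all [Fin.ext_iff] <;> omega
    · rintro ⟨i, hi⟩
      induction i using Fin.addCases with
      | left i => exact ⟨.inl i, rfl⟩
      | right i => exact ⟨.inr ⟨i, Nat.lt_of_add_lt_add_left hi⟩, rfl⟩)
  have hinl : ∀ i, (e (.inl i)).1 = Fin.castAdd p i := fun _ => rfl
  have hinr : ∀ i, (e (.inr i)).1 = Fin.natAdd m i.1 := fun _ => rfl
  have hsub : (matBlock x).submatrix (fun k => (e k).1) (fun k => (e k).1) =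
      Matrix.fromBlocks 1 ((matL x)ᵀ.submatrix id Subtype.val)
        ((matL x).submatrix Subtype.val id)
        ((matM x).submatrix Subtype.val Subtype.val) := by
    ext a b
    rcases a with a | a <;> rcases b with b | b <;> simp [hinl, hinr, matBlock]
  rw [minor_eq_det_submatrix _ e, hsub, Matrix.det_fromBlocks_one₁₁]
  rfl

lemma det_matBlock {m p : ℕ} (x : Coords m p) : (matBlock x).det = (schur x).det := by
  rw [matBlock, Matrix.det_reindex_self, Matrix.det_fromBlocks_one₁₁]
  rfl

lemma integrandBlock_eq {m p : ℕ} (lam sig : ℕ → ℂ) :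
    (integrandBlock lam sig : Coords m p → ℂ) = integrandSchur lam sig := by
  funext x
  simp only [integrandBlock, minor_matBlock, det_matBlock]
  rfl

/-! ### Recursion for the integrand -/

/-- The integrand with `λ_{p+1}` and `σ_{p+1}` not required to vanish: the additional factors are
`det (M - L Lᵗ) ^ λ_{p+1}` and `det (1 + M + N) ^ (-σ_{p+1})`. This makes the family stable under
integration over the last row and column. -/
noncomputable def extIntegrand {m p : ℕ} (lam sig : ℕ → ℂ) (x : Coords m p) : ℂ :=
  (∏ j ∈ Finset.Icc 1 p, (minor (schur x) j : ℂ) ^ (lam j - lam (j + 1)) /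
      (minor (shifted x) j : ℂ) ^ (sig j - sig (j + 1))) *
    (((schur x).det : ℂ) ^ (lam (p + 1) - ((m : ℂ) / 2 + p)) /
      ((shifted x).det : ℂ) ^ sig (p + 1))

lemma integrandSchur_eq {m p : ℕ} {lam sig : ℕ → ℂ} (hlam : lam (p + 1) = 0)
    (hsig : sig (p + 1) = 0) :
    (integrandSchur lam sig : Coords m p → ℂ) = extIntegrand lam sig := by
  funext x
  rw [integrandSchur, extIntegrand, hlam, hsig, Complex.cpow_zero, div_one]
  congr 2
  ring

/-- The shift of the parameters does not change the differences `λ_j - λ_{j+1}` and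
`σ_j - σ_{j+1}`, so only the powers of the full determinants have to be compared. -/
lemma extIntegrand_succ {m p : ℕ} (lam sig : ℕ → ℂ) {X : Coords m (p + 1)} {x : Coords m p}
    {E : Matrix (Fin p) (Fin p) ℝ} {z : QuadSpace m p × ℝ}
    (hX : restrictCoords X = (x, fibreMap x E z)) (hS : (schur x).PosDef)
    (hE : Eᵀ * schur x * E = 1) (hz : 0 < z.2) :
    extIntegrand lam sig X =
      extIntegrand (fun k => lam k - 1 / 2) (fun k => sig k - 1) x *
        (((shifted x).det * √(schur x).det : ℝ) : ℂ)⁻¹ *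
        model sumSq (lam (p + 1) - ((m : ℂ) / 2 + p)) (sig (p + 1)) z := by
  have hx : head X = x := congrArg Prod.fst hX
  have hA := shifted_det_pos hS
  have hD := hS.det_pos
  have hQ : 0 ≤ sumSq z.1 := by unfold sumSq; positivity
  have hτ : 0 < 1 + z.2 + sumSq z.1 := by linarith
  have hdS := schur_det_of_restrictCoords hX hD.ne'
  have hdA := shifted_det_of_restrictCoords hX hA.ne' hE
  have hprod : (∏ j ∈ Finset.Icc 1 p, (minor (schur X) j : ℂ) ^ (lam j - lam (j + 1)) /
      (minor (shifted X) j : ℂ) ^ (sig j - sig (j + 1))) =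
      ∏ j ∈ Finset.Icc 1 p,
        (minor (schur x) j : ℂ) ^ (lam j - 1 / 2 - (lam (j + 1) - 1 / 2)) /
        (minor (shifted x) j : ℂ) ^ (sig j - 1 - (sig (j + 1) - 1)) := by
    refine Finset.prod_congr rfl fun j hj => ?_
    rw [minor_succ _ (Finset.mem_Icc.1 hj).2, minor_succ _ (Finset.mem_Icc.1 hj).2,
      schur_submatrix, shifted_submatrix, hx, sub_sub_sub_cancel_right, sub_sub_sub_cancel_right]
  rw [extIntegrand, extIntegrand, Finset.prod_Icc_succ_top (by omega), hprod, minor_self,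
    minor_self, hdS, hdA, model, if_pos hz]
  generalize (∏ j ∈ Finset.Icc 1 p, _ : ℂ) = P
  generalize 1 + z.2 + sumSq z.1 = τ at *
  generalize (schur x).det = D at *
  generalize (shifted x).det = A at *
  obtain ⟨_, s⟩ := z
  simp only at hz ⊢
  have hDc : (D : ℂ) ≠ 0 := by exact_mod_cast hD.ne'
  have hAc : (A : ℂ) ≠ 0 := by exact_mod_cast hA.ne'
  have hDs : ((D * s : ℝ) : ℂ) ≠ 0 := by exact_mod_cast (mul_pos hD hz).ne'
  have hAτ : ((A * τ : ℝ) : ℂ) ≠ 0 := by exact_mod_cast (mul_pos hA hτ).ne'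
  have e1 : ((D * s : ℝ) : ℂ) ^ (lam (p + 1) - lam (p + 1 + 1)) *
      ((D * s : ℝ) : ℂ) ^ (lam (p + 1 + 1) - ((m : ℂ) / 2 + (p + 1 : ℕ))) =
      (D : ℂ) ^ (lam (p + 1) - ((m : ℂ) / 2 + p) - 1) *
        (s : ℂ) ^ (lam (p + 1) - ((m : ℂ) / 2 + p) - 1) := by
    rw [← Complex.cpow_add _ _ hDs, ← Complex.mul_cpow_ofReal_nonneg hD.le hz.le]
    push_cast
    congr 1
    ring
  have e2 : ((A * τ : ℝ) : ℂ) ^ (sig (p + 1) - sig (p + 1 + 1)) *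
      ((A * τ : ℝ) : ℂ) ^ sig (p + 1 + 1) =
      (A : ℂ) ^ sig (p + 1) * (τ : ℂ) ^ sig (p + 1) := by
    rw [← Complex.cpow_add _ _ hAτ, ← Complex.mul_cpow_ofReal_nonneg hA.le hτ.le]
    push_cast
    congr 1
    ring
  have e3 : (D : ℂ) ^ (lam (p + 1) - 1 / 2 - ((m : ℂ) / 2 + p)) * ((√D : ℝ) : ℂ)⁻¹ =
      (D : ℂ) ^ (lam (p + 1) - ((m : ℂ) / 2 + p) - 1) := by
    rw [Real.sqrt_eq_rpow, Complex.ofReal_cpow hD.le, ← Complex.cpow_neg,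
      ← Complex.cpow_add _ _ hDc]
    congr 1
    push_cast
    ring
  have e4 : (A : ℂ) ^ (sig (p + 1) - 1) * A = (A : ℂ) ^ sig (p + 1) := by
    rw [Complex.cpow_sub _ _ hAc, Complex.cpow_one, div_mul_cancel₀ _ hAc]
  rw [Complex.cpow_neg, Complex.ofReal_mul A (√D)]
  calc _ = P * (((D * s : ℝ) : ℂ) ^ (lam (p + 1) - lam (p + 1 + 1)) *
          ((D * s : ℝ) : ℂ) ^ (lam (p + 1 + 1) - ((m : ℂ) / 2 + (p + 1 : ℕ)))) /
        (((A * τ : ℝ) : ℂ) ^ (sig (p + 1) - sig (p + 1 + 1)) *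
          ((A * τ : ℝ) : ℂ) ^ sig (p + 1 + 1)) := by ring
    _ = _ := by
      rw [e1, e2, ← e3, ← e4]
      ring

/-! ### Measurability -/

lemma continuous_schur {m p : ℕ} : Continuous (schur : Coords m p → _) := by
  have hL : Continuous (matL : Coords m p → _) := by
    refine continuous_matrix fun i j => ?_
    simp only [matL, Matrix.of_apply]
    fun_prop
  have hM : Continuous (matM : Coords m p → _) := by
    refine continuous_matrix fun i j => ?_
    simp only [matM, Matrix.of_apply]
    split_ifs <;> fun_prop
  exact hM.sub (hL.matrix_mul hL.matrix_transpose)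

lemma continuous_shifted {m p : ℕ} : Continuous (shifted : Coords m p → _) := by
  refine continuous_matrix fun i j => ?_
  simp only [shifted, Matrix.add_apply, matM, matN, Matrix.of_apply]
  split_ifs <;> fun_prop

lemma continuous_minor {n : ℕ} (j : ℕ) :
    Continuous fun A : Matrix (Fin n) (Fin n) ℝ => minor A j :=
  (continuous_id.matrix_submatrix _ _).matrix_det

lemma measurable_extIntegrand {m p : ℕ} (lam sig : ℕ → ℂ) :
    Measurable (extIntegrand lam sig : Coords m p → ℂ) := by
  have h1 : ∀ j, Measurable fun x : Coords m p => (minor (schur x) j : ℂ) := fun j =>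
    (Complex.continuous_ofReal.comp ((continuous_minor j).comp continuous_schur)).measurable
  have h2 : ∀ j, Measurable fun x : Coords m p => (minor (shifted x) j : ℂ) := fun j =>
    (Complex.continuous_ofReal.comp ((continuous_minor j).comp continuous_shifted)).measurable
  unfold extIntegrand
  simp only [← minor_self]
  refine (Finset.measurable_prod _ fun j _ => ?_).mul ?_
  · exact ((h1 j).pow_const _).div ((h2 j).pow_const _)
  · exact ((h1 p).pow_const _).div ((h2 p).pow_const _)

lemma posDef_schur_iff {m p : ℕ} (X : Coords m (p + 1)) :
    (schur X).PosDef ↔ (schur (head X)).PosDef ∧ 0 < (schur X).det := by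
  rw [posDef_succ_iff (schur_isHermitian X), schur_submatrix]

lemma measurableSet_posDef_schur (m p : ℕ) :
    MeasurableSet {x : Coords m p | (schur x).PosDef} := by
  induction p with
  | zero =>
    have h : {x : Coords m 0 | (schur x).PosDef} = Set.univ := by
      refine Set.eq_univ_of_forall fun x => ?_
      change (schur x).PosDef
      rw [Subsingleton.elim (schur x) 1]
      exact Matrix.PosDef.one
    rw [h]
    exact MeasurableSet.univ
  | succ p ih =>
    obtain ⟨e, -, he⟩ := exists_coordsEquiv m p
    have hh : Measurable (head : Coords m (p + 1) → Coords m p) := by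
      have := measurable_fst.comp e.measurable
      convert this using 1
      funext x
      rw [Function.comp_apply, he]
    simp only [posDef_schur_iff]
    exact (hh ih).inter (measurableSet_lt measurable_const continuous_schur.matrix_det.measurable)

/-! ### Integration over the last row and column -/

/-- The integrand, extended by zero outside of the domain `M - L Lᵗ > 0`. -/
noncomputable def extIndicator {m p : ℕ} (lam sig : ℕ → ℂ) : Coords m p → ℂ :=
  Set.indicator {x | (schur x).PosDef} (extIntegrand lam sig)

lemma measurable_extIndicator {m p : ℕ} (lam sig : ℕ → ℂ) :
    Measurable (extIndicator lam sig : Coords m p → ℂ) :=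
  (measurable_extIntegrand lam sig).indicator (measurableSet_posDef_schur m p)

lemma extIndicator_of_not_posDef {m p : ℕ} (lam sig : ℕ → ℂ) {X : Coords m (p + 1)}
    (h : ¬ (schur (head X)).PosDef) : extIndicator lam sig X = 0 :=
  Set.indicator_of_notMem (s := {x | (schur x).PosDef})
    (fun hX => h ((posDef_schur_iff X).1 hX).1) _

lemma extIndicator_succ {m p : ℕ} (lam sig : ℕ → ℂ) {X : Coords m (p + 1)} {x : Coords m p}
    {E : Matrix (Fin p) (Fin p) ℝ} {z : QuadSpace m p × ℝ}
    (hX : restrictCoords X = (x, fibreMap x E z)) (hS : (schur x).PosDef)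
    (hE : Eᵀ * schur x * E = 1) :
    extIndicator lam sig X =
      extIndicator (fun k => lam k - 1 / 2) (fun k => sig k - 1) x *
        (((shifted x).det * √(schur x).det : ℝ) : ℂ)⁻¹ *
        model sumSq (lam (p + 1) - ((m : ℂ) / 2 + p)) (sig (p + 1)) z := by
  have hx : head X = x := congrArg Prod.fst hX
  have hdS := schur_det_of_restrictCoords hX hS.det_pos.ne'
  have hiff : (schur X).PosDef ↔ 0 < z.2 := by
    rw [posDef_schur_iff, hx, hdS, mul_pos_iff_of_pos_left hS.det_pos]
    exact and_iff_right hS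
  rw [extIndicator, extIndicator, Set.indicator_of_mem (a := x) (by exact hS)]
  by_cases hz : 0 < z.2
  · rw [Set.indicator_of_mem (by exact hiff.2 hz), extIntegrand_succ lam sig hX hS hE hz]
  · rw [Set.indicator_of_notMem (by exact fun h => hz (hiff.1 h)), model, if_neg hz, mul_zero]

/-- Over each point of `Coords m p`, the integrals of the integrand and of its norm over the last
row and column are those of the model integrand, times the integrand for `p` with shifted
parameters. The Jacobian of `fibreMap` cancels the remaining powers of determinants. -/
lemma integral_fibre {m p : ℕ} (lam sig : ℕ → ℂ)
    (hint : Integrable (model (sumSq (m := m) (p := p)) (lam (p + 1) - ((m : ℂ) / 2 + p))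
      (sig (p + 1))))
    {e : Coords m (p + 1) ≃ᵐ Coords m p × LastCoords m p} (he : ∀ X, e X = restrictCoords X)
    (x : Coords m p) :
    Integrable (fun y => extIndicator lam sig (e.symm (x, y))) ∧
    ∫ y, extIndicator lam sig (e.symm (x, y)) =
      extIndicator (fun k => lam k - 1 / 2) (fun k => sig k - 1) x *
        ∫ z, model (sumSq (m := m) (p := p)) (lam (p + 1) - ((m : ℂ) / 2 + p)) (sig (p + 1)) z ∧
    ∫ y, ‖extIndicator lam sig (e.symm (x, y))‖ =
      ‖extIndicator (fun k => lam k - 1 / 2) (fun k => sig k - 1) x‖ *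
        ∫ z, ‖model (sumSq (m := m) (p := p)) (lam (p + 1) - ((m : ℂ) / 2 + p))
          (sig (p + 1)) z‖ := by
  have hres : ∀ y, restrictCoords (e.symm (x, y)) = (x, y) := fun y => by
    rw [← he, e.apply_symm_apply]
  by_cases hS : (schur x).PosDef
  · obtain ⟨E, hE, hdet⟩ := exists_symm_mul_mul_eq_one hS
    have hA := shifted_det_pos hS
    have hD := Real.sqrt_pos.2 hS.det_pos
    have hk := mul_pos hA hD
    have hmp := measurePreserving_fibreMap x E hA.ne' (by
      rw [← abs_pos, hdet]; exact hD)
    rw [hdet, abs_of_pos hA] at hmp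
    have hmeas : Measurable fun y => extIndicator lam sig (e.symm (x, y)) :=
      (measurable_extIndicator lam sig).comp (e.symm.measurable.comp measurable_prodMk_left)
    have heq := fun z => extIndicator_succ lam sig (hres (fibreMap x E z)) hS hE
    refine ⟨?_, ?_, ?_⟩
    · rw [← hmp.integrable_comp hmeas.aestronglyMeasurable]
      refine Integrable.smul_measure ?_ ENNReal.ofReal_ne_top
      exact (hint.const_mul _).congr (.of_forall fun z => (heq z).symm)
    · rw [← hmp.map_eq, integral_map hmp.aemeasurable hmeas.aestronglyMeasurable]
      simp only [heq]
      rw [integral_smul_measure, ENNReal.toReal_ofReal hk.le, integral_const_mul,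
        Complex.real_smul, ← mul_assoc, mul_left_comm, mul_inv_cancel₀, mul_one]
      exact_mod_cast hk.ne'
    · rw [← hmp.map_eq, integral_map hmp.aemeasurable hmeas.norm.aestronglyMeasurable]
      simp only [heq, norm_mul]
      rw [integral_smul_measure, ENNReal.toReal_ofReal hk.le, integral_const_mul,
        norm_inv, Complex.norm_real, Real.norm_of_nonneg hk.le, smul_eq_mul, ← mul_assoc, mul_left_comm,
        mul_inv_cancel₀ hk.ne', mul_one]
  · have h0 : extIndicator (fun k => lam k - 1 / 2) (fun k => sig k - 1) x = 0 :=
      Set.indicator_of_notMem (s := {x | (schur x).PosDef}) hS _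
    have h1 : ∀ y, extIndicator lam sig (e.symm (x, y)) = 0 := fun y =>
      extIndicator_of_not_posDef _ _ (by rw [head, hres]; exact hS)
    refine ⟨?_, ?_, ?_⟩
    · simp only [h1]
      exact integrable_zero _ _ _
    · simp only [h1, h0, integral_zero, zero_mul]
    · simp only [h1, h0, norm_zero, integral_zero, zero_mul]

/-- The factor with index `k` on the right hand side. -/
noncomputable def gammaFactor (m p : ℕ) (lam sig : ℕ → ℂ) (k : ℕ) : ℂ :=
  (Real.pi : ℂ) ^ ((k : ℂ) + (m : ℂ) / 2 - 1) *
    (Complex.Gamma (lam k - ((m : ℂ) + p + k) / 2 + 1) *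
        Complex.Gamma (sig k - lam k - ((p : ℂ) - k) / 2) /
      Complex.Gamma (sig k - p + k))

/-- The factors are invariant under the shift of the parameters that goes with `p + 1 ↦ p`. -/
lemma gammaFactor_succ (m p : ℕ) (lam sig : ℕ → ℂ) (k : ℕ) :
    gammaFactor m (p + 1) lam sig k =
      gammaFactor m p (fun k => lam k - 1 / 2) (fun k => sig k - 1) k := by
  unfold gammaFactor
  push_cast
  congr 3
  · congr 1
    ring
  · congr 1
    ring
  · ring

/-- The integral over a fibre is the factor of the right hand side with the largest index. -/
lemma model_integral (m p : ℕ) {lam sig : ℕ → ℂ}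
    (hlower : ((m : ℝ) + p) / 2 + (p : ℝ) / 2 < (lam (p + 1)).re)
    (hupper : (lam (p + 1)).re < (sig (p + 1)).re) :
    Integrable (model (sumSq (m := m) (p := p)) (lam (p + 1) - ((m : ℂ) / 2 + p))
      (sig (p + 1))) ∧
    ∫ z, model (sumSq (m := m) (p := p)) (lam (p + 1) - ((m : ℂ) / 2 + p)) (sig (p + 1)) z =
      gammaFactor m (p + 1) lam sig (p + 1) := by
  have hG : IsGaussianForm (sumSq (m := m) (p := p)) ((p : ℝ) / 2 + ((m : ℝ) / 2 + (p : ℝ) / 2)) :=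
    (isGaussianForm_sum_sq p).add ((isGaussianForm_sum_sq m).add (isGaussianForm_sum_sq p))
  have hmp : (0 : ℝ) ≤ ((m : ℝ) + p) / 2 + (p : ℝ) / 2 := by positivity
  have hre : ((m : ℂ) / 2 + p).re = (m : ℝ) / 2 + p := by
    rw [show (m : ℂ) / 2 + p = (((m : ℝ) / 2 + p : ℝ) : ℂ) by push_cast; rfl, Complex.ofReal_re]
  have h := integrable_model_and_integral hG
    (a := lam (p + 1) - ((m : ℂ) / 2 + p)) (σ := sig (p + 1))
    (by rw [Complex.sub_re, hre]; linarith)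
    (by rw [Complex.sub_re, Complex.sub_re, Complex.sub_re, hre, Complex.ofReal_re]; linarith)
    (by linarith)
  refine ⟨h.1, h.2.trans ?_⟩
  unfold gammaFactor
  push_cast
  congr 3
  · ring
  · congr 1
    ring
  · congr 1
    ring
  · ring

/-- The value does not depend on `λ_{p+1}` and `σ_{p+1}`: the full determinants occur with the total
exponents `λ_p - (m + 2 p) / 2` and `-σ_p`. -/
lemma integrable_extIndicator_and_integral (m p : ℕ) : ∀ lam sig : ℕ → ℂ,
    (∀ k ∈ Finset.Icc 1 p, ((m : ℝ) + p + k) / 2 - 1 < (lam k).re) →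
    (∀ k ∈ Finset.Icc 1 p, (lam k).re < (sig k).re - ((p : ℝ) - k) / 2) →
    Integrable (extIndicator lam sig : Coords m p → ℂ) ∧
      ∫ x : Coords m p, extIndicator lam sig x =
        ∏ k ∈ Finset.Icc 1 p, gammaFactor m p lam sig k := by
  induction p with
  | zero =>
    intro lam sig _ _
    have h1 : (extIndicator lam sig : Coords m 0 → ℂ) = fun _ => 1 := by
      funext x
      have hS : schur x = 1 := Subsingleton.elim _ _
      rw [extIndicator, Set.indicator_of_mem]
      · simp [extIntegrand]
      · change (schur x).PosDef
        rw [hS]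
        exact Matrix.PosDef.one
    have hempty : ∀ (ι E : Type) [Fintype ι] [IsEmpty ι] [MeasureSpace E]
        [SigmaFinite (volume : Measure E)], (volume : Measure (ι → E)) Set.univ = 1 := by
      intro ι E _ _ _ _
      rw [volume_pi, Measure.pi_univ, Finset.univ_eq_empty, Finset.prod_empty]
    have hv : (volume : Measure (Coords m 0)) Set.univ = 1 := by
      rw [← Set.univ_prod_univ, Measure.volume_eq_prod, Measure.prod_prod,
        ← Set.univ_prod_univ, Measure.volume_eq_prod, Measure.prod_prod, hempty, hempty, hempty,
        one_mul, one_mul]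
    have : IsFiniteMeasure (volume : Measure (Coords m 0)) := ⟨by rw [hv]; exact ENNReal.one_lt_top⟩
    rw [h1]
    refine ⟨integrable_const _, ?_⟩
    simp [Measure.real, hv]
  | succ p ih =>
    intro lam sig hlower hupper
    have hmem : ∀ k ∈ Finset.Icc 1 p, k ∈ Finset.Icc 1 (p + 1) := fun k hk =>
      Finset.Icc_subset_Icc_right (Nat.le_succ p) hk
    have htop : p + 1 ∈ Finset.Icc 1 (p + 1) := Finset.mem_Icc.2 ⟨by omega, le_rfl⟩
    have hl := hlower _ htop
    have hu := hupper _ htop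
    push_cast at hl hu
    obtain ⟨hi, hv⟩ := model_integral m p (lam := lam) (sig := sig) (by linarith) (by linarith)
    have hhalf : ((1 : ℂ) / 2).re = 1 / 2 := by norm_num
    obtain ⟨ihi, ihv⟩ := ih (fun k => lam k - 1 / 2) (fun k => sig k - 1)
      (fun k hk => by
        have := hlower k (hmem k hk)
        push_cast at this
        rw [Complex.sub_re, hhalf]
        linarith)
      (fun k hk => by
        have := hupper k (hmem k hk)
        push_cast at this
        rw [Complex.sub_re, Complex.sub_re, hhalf, Complex.one_re]
        linarith)
    obtain ⟨e, hmp, he⟩ := exists_coordsEquiv m p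
    have hfib := integral_fibre lam sig hi he
    have hG : Integrable (fun w => extIndicator lam sig (e.symm w)) := by
      have hm : Measurable fun w => extIndicator lam sig (e.symm w) :=
        (measurable_extIndicator lam sig).comp e.symm.measurable
      rw [Measure.volume_eq_prod, integrable_prod_iff hm.aestronglyMeasurable]
      refine ⟨.of_forall fun x => (hfib x).1, ?_⟩
      simp only [(hfib _).2.2]
      exact ihi.norm.mul_const _
    have hsymm := hmp.symm e
    refine ⟨(hsymm.integrable_comp_emb e.symm.measurableEmbedding).1 hG, ?_⟩
    rw [← hsymm.integral_comp e.symm.measurableEmbedding, Measure.volume_eq_prod,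
      integral_prod _ hG]
    simp only [(hfib _).2.1]
    rw [integral_mul_const, ihv, hv, Finset.prod_Icc_succ_top (by omega)]
    simp only [gammaFactor_succ m p lam sig]

end WedgeB

theorem theorem3p1 (p q : ℕ) (hp : 1 ≤ p) (hpq : p ≤ q) (lam sig : ℕ → ℂ)
    (hlam_last : lam (p + 1) = 0) (hsig_last : sig (p + 1) = 0)
    (hlower : ∀ k ∈ Finset.Icc 1 p, ((q : ℝ) + k) / 2 - 1 < (lam k).re)
    (hupper : ∀ k ∈ Finset.Icc 1 p, (lam k).re < (sig k).re - ((p : ℝ) - k) / 2) :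
    MeasureTheory.IntegrableOn (WedgeB.integrandSchur lam sig)
        (WedgeB.sectionDomain (q - p) p) ∧
      MeasureTheory.IntegrableOn (WedgeB.integrandBlock lam sig)
        (WedgeB.posDomain (q - p) p) ∧
      ∫ x in WedgeB.sectionDomain (q - p) p, WedgeB.integrandSchur lam sig x =
        ∫ x in WedgeB.posDomain (q - p) p, WedgeB.integrandBlock lam sig x ∧
      ∫ x in WedgeB.posDomain (q - p) p, WedgeB.integrandBlock lam sig x =
        ∏ k ∈ Finset.Icc 1 p,
          (Real.pi : ℂ) ^ ((k : ℂ) + ((q : ℂ) - p) / 2 - 1) *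
            (Complex.Gamma (lam k - ((q : ℂ) + k) / 2 + 1) *
                Complex.Gamma (sig k - lam k - ((p : ℂ) - k) / 2) /
              Complex.Gamma (sig k - p + k)) := by
  obtain ⟨m, rfl⟩ := Nat.exists_eq_add_of_le' hpq
  push_cast at hlower
  have hmeas := WedgeB.measurableSet_posDef_schur m p
  obtain ⟨hi, hv⟩ := WedgeB.integrable_extIndicator_and_integral m p lam sig hlower hupper
  rw [WedgeB.extIndicator, integrable_indicator_iff hmeas] at hi
  simp only [WedgeB.extIndicator] at hv
  rw [integral_indicator hmeas] at hv
  rw [Nat.add_sub_cancel, WedgeB.integrandBlock_eq, WedgeB.sectionDomain_eq, WedgeB.posDomain_eq,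
    WedgeB.integrandSchur_eq hlam_last hsig_last]
  refine ⟨hi, hi, rfl, hv.trans ?_⟩
  push_cast
  rw [add_sub_cancel_right]
  rfl
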